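/- Define classes of groups $EG_\alpha$ by transfinite recursion on the ordinal $\alpha$: $EG_0$ is the class of all finite groups and all abelian groups; $EG_{\beta+1}$ is the class of all groups $G$ that either have a normal subgroup $N$ with $N\in EG_\beta$ and $G/N\in EG_\beta$, or are the union of a family of subgroups, directed by inclusion, all of which lie in $EG_\beta$; and $EG_\alpha=\bigcup_{\beta<\alpha}EG_\beta$ if $\alpha$ is a (nonzero) limit ordinal. A group $G$ is elementary amenable if it lies in some $EG_\alpha$; its elementary class $c(G)$ is then the smallest ordinal $\alpha$ with $G\in EG_\alpha$. For a group $H$, let $\mathcal E(H)$ be the class of all groups $K$ such that every finitely generated subgroup of $K$ embeds in a finite direct power of $H$. Let $G^\omega$ denote the direct product of countably infinitely many copies of $G$ (the group of all sequences in $G$ with finite support, under pointwise multiplication). **Proposition.** Let $\alpha$ be a countable (nonzero) limit ordinal. (a) There exists a countable group $H$ such that $c(H)=\alpha+1$ and every $K\in\mathcal E(H)$ is elementary amenable with $c(K)\le\alpha+1$. (b) For every $n\in\mathbb N$ with $n\ge 2$, there exists a finitely generated group $L$ such that $c(L)=c(L^\omega)=\alpha+n$. -/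

import Mathlib

universe u

/-- The class `EG_α` of the elementary amenable hierarchy, by transfinite recursion on `α`:
* `EG_0` consists of all finite and all abelian groups;
* `EG_{β+1}` consists of the groups obtained from groups in `EG_β` by one extension, or by one
  direct union (the union of a set of subgroups directed by inclusion);
* `EG_α` is the union of the `EG_β`, `β < α`, if `α` is a (nonzero) limit ordinal. -/
noncomputable def EG (α : Ordinal.{u}) : ∀ (G : Type u) [Group G], Prop :=
  Ordinal.limitRecOn (motive := fun _ => ∀ (G : Type u) [Group G], Prop) α
    (fun G _ => Finite G ∨ ∀ a b : G, a * b = b * a)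
    (fun _ C G _ =>
      (∃ (N : Subgroup G) (_ : N.Normal), C N ∧ C (G ⧸ N)) ∨
      (∃ 𝒮 : Set (Subgroup G), DirectedOn (· ≤ ·) 𝒮 ∧ (∀ g : G, ∃ S ∈ 𝒮, g ∈ S) ∧
        ∀ S ∈ 𝒮, C S))
    (fun α _ C G _ => ∃ (β : Ordinal.{u}) (h : β < α), C β h G)

theorem EG_zero_iff (G : Type u) [Group G] :
    EG 0 G ↔ Finite G ∨ ∀ a b : G, a * b = b * a := by
  simp only [EG, Ordinal.limitRecOn_zero]

theorem EG_add_one_iff (β : Ordinal.{u}) (G : Type u) [Group G] :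
    EG (β + 1) G ↔
      (∃ (N : Subgroup G) (_ : N.Normal), EG β N ∧ EG β (G ⧸ N)) ∨
      (∃ 𝒮 : Set (Subgroup G), DirectedOn (· ≤ ·) 𝒮 ∧ (∀ g : G, ∃ S ∈ 𝒮, g ∈ S) ∧
        ∀ S ∈ 𝒮, EG β S) := by
  simp only [EG, Ordinal.limitRecOn_add_one]

theorem EG_limit_iff {α : Ordinal.{u}} (hα : Order.IsSuccLimit α) (G : Type u) [Group G] :
    EG α G ↔ ∃ β < α, EG β G := by
  simp only [EG, Ordinal.limitRecOn_limit _ _ _ _ hα, exists_prop]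

/-- `HasElementaryClass G α`: the elementary class `c(G)` is defined (that is, `G` lies in some
`EG_β`, so `G` is elementary amenable), and `c(G) = α`, i.e. `α` is the smallest ordinal such that
`G` belongs to `EG_α`. -/
def HasElementaryClass (G : Type u) [Group G] (α : Ordinal.{u}) : Prop :=
  IsLeast {β : Ordinal.{u} | EG β G} α

/-- `MemE H K`: the group `K` belongs to the class `𝓔(H)`, i.e. every finitely generated subgroup
of `K` embeds in a (finite) direct power of `H`. -/
def MemE (H : Type u) [Group H] (K : Type u) [Group K] : Prop :=
  ∀ S : Subgroup K, S.FG → ∃ (m : ℕ) (f : S →* (Fin m → H)), Function.Injective f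

/-- The direct product `G^ω` of countably many copies of `G`: the sequences in `G`
with finite support, under pointwise multiplication. -/
def directPowerOmega (G : Type u) [Group G] : Subgroup (ℕ → G) where
  carrier := {f | (Function.mulSupport f).Finite}
  mul_mem' {f g} hf hg := (hf.union hg).subset (Function.mulSupport_mul f g)
  one_mem' := by simp
  inv_mem' {f} hf := by simpa [Function.mulSupport_inv] using hf

open Order

/-! ### Closure properties of the hierarchy -/

section EGBasics

/-! For a limit `α`, `EG α` is closed under extensions, since the two pieces already lie in a common
earlier stage. A finitely generated group gains nothing from direct unions, so if it is outside `EG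
α` it is outside `EG (α + 1)` too.

For (a), `H` is the restricted direct product of finitely generated groups `G_β` in `EG α` but
outside `EG β`, for all `β < α`. It maps onto every `G_β`, so it is outside `EG α`. Its finitely
generated subgroups live in finitely many coordinates, so they are in `EG α`; this local property
passes to the class 𝓔(H) and gives the bound `α + 1`.

The `G_β` come from transfinite induction (`exists_fg_not_EG`). Successor stages use the restricted
wreath product of `G` with itself: a normal subgroup either acts trivially, so that the quotient
maps onto `G`, or has `G` as a section. At limit stages the countable group `H` becomes a
two-generated group `L`, spanned by a translation of ℤ and a function listing `H` along the powers
of two. Two distinct translates of that function overlap in at most one point, so the base stays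
locally in `EG α` (`lacunaryBase_locallyEG`), while commutators of translates recover the derived
subgroup of `H`. Thus `L` has class `α + 2`.

For (b), `L` is replaced repeatedly by its wreath product with itself, each time raising the class
by one. The upper bounds are proved for all restricted powers at once, which covers `L^ω`. -/

theorem EG_of_injective (β : Ordinal.{u}) :
    ∀ {G G' : Type u} [Group G] [Group G'] (f : G' →* G), Function.Injective f →
      EG β G → EG β G' := by
  induction β using Ordinal.limitRecOn with
  | zero =>
    intro G G' _ _ f hf h
    rw [EG_zero_iff] at h ⊢
    rcases h with h | h
    · exact Or.inl (Finite.of_injective f hf)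
    · exact Or.inr fun a b => hf (by rw [map_mul, map_mul, h])
  | add_one β ih =>
    intro G G' _ _ f hf h
    rw [EG_add_one_iff] at h ⊢
    rcases h with ⟨N, hN, h1, h2⟩ | ⟨S, hd, hc, hS⟩
    · refine Or.inl ⟨N.comap f, inferInstance, ih (f.subgroupComap N) ?_ h1,
        ih (QuotientGroup.map (N.comap f) N f le_rfl) ?_ h2⟩
      · intro x y hxy
        exact Subtype.ext (hf (congrArg Subtype.val hxy))
      · rw [← MonoidHom.ker_eq_bot_iff, QuotientGroup.ker_map, QuotientGroup.map_mk'_self]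
    · refine Or.inr ⟨(Subgroup.comap f) '' S, ?_, ?_, ?_⟩
      · rintro _ ⟨A, hA, rfl⟩ _ ⟨B, hB, rfl⟩
        obtain ⟨C, hC, hAC, hBC⟩ := hd A hA B hB
        exact ⟨_, ⟨C, hC, rfl⟩, Subgroup.comap_mono hAC, Subgroup.comap_mono hBC⟩
      · intro g
        obtain ⟨A, hA, hg⟩ := hc (f g)
        exact ⟨_, ⟨A, hA, rfl⟩, hg⟩
      · rintro _ ⟨A, hA, rfl⟩
        exact ih (f.subgroupComap A) (fun x y hxy => Subtype.ext (hf (congrArg Subtype.val hxy)))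
          (hS A hA)
  | limit β hβ ih =>
    intro G G' _ _ f hf h
    rw [EG_limit_iff hβ] at h ⊢
    obtain ⟨γ, hγ, h⟩ := h
    exact ⟨γ, hγ, ih γ hγ f hf h⟩

theorem EG_of_surjective (β : Ordinal.{u}) :
    ∀ {G G' : Type u} [Group G] [Group G'] (f : G →* G'), Function.Surjective f →
      EG β G → EG β G' := by
  induction β using Ordinal.limitRecOn with
  | zero =>
    intro G G' _ _ f hf h
    rw [EG_zero_iff] at h ⊢
    rcases h with h | h
    · exact Or.inl (Finite.of_surjective f hf)
    · refine Or.inr fun a b => ?_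
      obtain ⟨a, rfl⟩ := hf a
      obtain ⟨b, rfl⟩ := hf b
      rw [← map_mul, ← map_mul, h]
  | add_one β ih =>
    intro G G' _ _ f hf h
    rw [EG_add_one_iff] at h ⊢
    rcases h with ⟨N, hN, h1, h2⟩ | ⟨S, hd, hc, hS⟩
    · have hN' : (N.map f).Normal := hN.map f hf
      refine Or.inl ⟨N.map f, hN', ih (f.subgroupMap N) (f.subgroupMap_surjective N) h1,
        ih (QuotientGroup.map N (N.map f) f (Subgroup.le_comap_map f N)) ?_ h2⟩
      exact QuotientGroup.map_surjective_of_surjective _ _ _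
        ((QuotientGroup.mk'_surjective _).comp hf) _
    · refine Or.inr ⟨(Subgroup.map f) '' S, ?_, ?_, ?_⟩
      · rintro _ ⟨A, hA, rfl⟩ _ ⟨B, hB, rfl⟩
        obtain ⟨C, hC, hAC, hBC⟩ := hd A hA B hB
        exact ⟨_, ⟨C, hC, rfl⟩, Subgroup.map_mono hAC, Subgroup.map_mono hBC⟩
      · intro g
        obtain ⟨g, rfl⟩ := hf g
        obtain ⟨A, hA, hg⟩ := hc g
        exact ⟨_, ⟨A, hA, rfl⟩, Subgroup.mem_map_of_mem f hg⟩
      · rintro _ ⟨A, hA, rfl⟩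
        exact ih (f.subgroupMap A) (f.subgroupMap_surjective A) (hS A hA)
  | limit β hβ ih =>
    intro G G' _ _ f hf h
    rw [EG_limit_iff hβ] at h ⊢
    obtain ⟨γ, hγ, h⟩ := h
    exact ⟨γ, hγ, ih γ hγ f hf h⟩

theorem EG_add_one_of_EG {β : Ordinal.{u}} {G : Type u} [Group G] (h : EG β G) :
    EG (β + 1) G := by
  rw [EG_add_one_iff]
  refine Or.inr ⟨{⊤}, ?_, fun g => ⟨⊤, rfl, trivial⟩, ?_⟩
  · rintro _ rfl _ rfl
    exact ⟨⊤, rfl, le_rfl, le_rfl⟩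
  · rintro _ rfl
    exact EG_of_injective β (Subgroup.subtype ⊤) (Subgroup.subtype_injective _) h

theorem EG_mono {β γ : Ordinal.{u}} (hβγ : β ≤ γ) {G : Type u} [Group G] (h : EG β G) :
    EG γ G := by
  induction γ using Ordinal.limitRecOn with
  | zero => rwa [← nonpos_iff_eq_zero.mp hβγ]
  | add_one γ ih =>
    rcases hβγ.lt_or_eq with hlt | rfl
    · exact EG_add_one_of_EG (ih (Order.lt_add_one_iff.mp hlt))
    · exact h
  | limit γ hγ ih =>
    rcases hβγ.lt_or_eq with hlt | rfl
    · exact (EG_limit_iff hγ G).mpr ⟨β, hlt, h⟩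
    · exact h

theorem EG_of_comm (β : Ordinal.{u}) {G : Type u} [Group G] (h : ∀ a b : G, a * b = b * a) :
    EG β G :=
  EG_mono zero_le ((EG_zero_iff G).mpr (Or.inr h))

theorem EG_add_one_of_hom {β : Ordinal.{u}} {G : Type u} [Group G] {Q : Type*} [Group Q]
    (f : G →* Q) {R : Type u} [Group R] (e : f.range →* R) (he : Function.Injective e)
    (hk : EG β f.ker) (hr : EG β R) : EG (β + 1) G := by
  rw [EG_add_one_iff]
  refine Or.inl ⟨f.ker, inferInstance, hk, ?_⟩
  exact EG_of_injective β (e.comp (QuotientGroup.quotientKerEquivRange f).toMonoidHom)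
    (he.comp (QuotientGroup.quotientKerEquivRange f).injective) hr

/-- Kernel and range both occur at some stage below `α`, and one further step stays below the limit.
-/
theorem EG_limit_of_hom {α : Ordinal.{u}} (hα : IsSuccLimit α) {G : Type u} [Group G]
    {Q : Type u} [Group Q] (f : G →* Q) (hk : EG α f.ker) (hr : EG α f.range) : EG α G := by
  rw [EG_limit_iff hα] at hk hr ⊢
  obtain ⟨β, hβ, hk⟩ := hk
  obtain ⟨γ, hγ, hr⟩ := hr
  exact ⟨max β γ + 1, hα.add_one_lt (max_lt hβ hγ),
    EG_add_one_of_hom f (MonoidHom.id _) Function.injective_id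
      (EG_mono (le_max_left _ _) hk) (EG_mono (le_max_right _ _) hr)⟩

/-- Coordinates are peeled off one at a time, each being an extension that a limit stage absorbs. -/
theorem EG_limit_of_finset {α : Ordinal.{u}} (hα : IsSuccLimit α) {ι : Type*}
    {G : ι → Type u} [∀ i, Group (G i)] (s : Finset ι) :
    ∀ {W : Type u} [Group W] (p : ∀ i, W →* G i),
    (∀ w, (∀ i ∈ s, p i w = 1) → w = 1) → (∀ i ∈ s, EG α (p i).range) → EG α W := by
  classical
  induction s using Finset.induction_on with
  | empty =>
    intro W _ p hp _
    exact EG_of_comm _ fun a b => by rw [hp a (by simp), hp b (by simp)]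
  | insert a s ha ih =>
    intro W _ p hp hr
    refine EG_limit_of_hom hα (p a) ?_ (hr a (Finset.mem_insert_self _ _))
    refine ih (fun i => (p i).comp (p a).ker.subtype) ?_ ?_
    · intro w hw
      refine Subtype.ext (hp w fun i hi => ?_)
      rcases Finset.mem_insert.mp hi with rfl | hi
      · exact w.2
      · exact hw i hi
    · intro i hi
      have hle : ((p i).comp (p a).ker.subtype).range ≤ (p i).range := by
        rintro _ ⟨w, rfl⟩
        exact ⟨w, rfl⟩
      exact EG_of_injective α (Subgroup.inclusion hle) (Subgroup.inclusion_injective hle)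
        (hr i (Finset.mem_insert_of_mem hi))

theorem Group.fg_of_subgroup_fg_map {G Q : Type*} [Group G] [Group Q] (f : G →* Q)
    {S : Subgroup G} (hS : S.FG) : (S.map f).FG := by
  classical
  obtain ⟨s, rfl⟩ := hS
  exact ⟨s.image f, by rw [Finset.coe_image, MonoidHom.map_closure]⟩

/-- A finitely generated group which is a direct union of groups in `EG β` is in `EG β`, so
membership in `EG (β + 1)` comes from an extension. -/
theorem not_EG_add_one_of_fg {β : Ordinal.{u}} {G : Type u} [Group G] [hG : Group.FG G]
    (h : ∀ (N : Subgroup G) (_ : N.Normal), EG β N → EG β (G ⧸ N) → False)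
    (h0 : ¬ EG β G) : ¬ EG (β + 1) G := by
  intro hE
  rw [EG_add_one_iff] at hE
  rcases hE with ⟨N, hN, h1, h2⟩ | ⟨S, hd, hc, hS⟩
  · exact h N hN h1 h2
  · obtain ⟨s, hs⟩ := hG.out
    have key : ∀ t : Finset G, ∃ A ∈ S, (t : Set G) ⊆ A := by
      classical
      intro t
      induction t using Finset.induction_on with
      | empty =>
        obtain ⟨A, hA, -⟩ := hc 1
        exact ⟨A, hA, by simp⟩
      | insert a t _ ih =>
        obtain ⟨A, hA, hA'⟩ := ih
        obtain ⟨B, hB, hB'⟩ := hc a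
        obtain ⟨C, hC, hAC, hBC⟩ := hd A hA B hB
        refine ⟨C, hC, ?_⟩
        rw [Finset.coe_insert, Set.insert_subset_iff]
        exact ⟨hBC hB', hA'.trans hAC⟩
    obtain ⟨A, hA, hsA⟩ := key s
    have hAtop : A = ⊤ := top_le_iff.mp (hs ▸ (Subgroup.closure_le A).mpr hsA)
    subst hAtop
    exact h0 (EG_of_surjective β (Subgroup.subtype ⊤) (fun x => ⟨⟨x, trivial⟩, rfl⟩) (hS _ hA))

end EGBasics

/-! ### Subgroups of restricted direct powers -/

section RestrictedPowers

/-- `W` embeds in a restricted direct power of `G`. -/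
def EmbedsInRestrictedPower (W G : Type u) [Group W] [Group G] : Prop :=
  ∃ (ι : Type u) (p : ι → W →* G), (∀ w, (∀ i, p i w = 1) → w = 1) ∧
    ∀ w, {i | p i w ≠ 1}.Finite

namespace EmbedsInRestrictedPower

theorem of_injective {W G : Type u} [Group W] [Group G] (f : W →* G)
    (hf : Function.Injective f) : EmbedsInRestrictedPower W G :=
  ⟨PUnit, fun _ => f, fun w hw => (injective_iff_map_eq_one f).mp hf w (hw ⟨⟩),
    fun _ => Set.toFinite _⟩

theorem refl (G : Type u) [Group G] : EmbedsInRestrictedPower G G :=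
  of_injective (MonoidHom.id G) Function.injective_id

theorem trans {U V W : Type u} [Group U] [Group V] [Group W]
    (h : EmbedsInRestrictedPower U V) (h' : EmbedsInRestrictedPower V W) :
    EmbedsInRestrictedPower U W := by
  obtain ⟨ι, p, hp, hpf⟩ := h
  obtain ⟨κ, q, hq, hqf⟩ := h'
  refine ⟨ι × κ, fun x => (q x.2).comp (p x.1),
    fun w hw => hp w fun i => hq _ fun k => hw (i, k), fun w => ?_⟩
  refine ((hpf w).biUnion fun i _ => ((hqf (p i w)).image (Prod.mk i))).subset ?_
  rintro ⟨i, k⟩ hik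
  simp only [Set.mem_iUnion]
  refine ⟨i, fun h1 => hik ?_, k, hik, rfl⟩
  simp [h1]

/-- The kernel and the range of the map induced on a restricted power by a homomorphism. -/
theorem exists_hom {W G Q : Type u} [Group W] [Group G] [Group Q]
    (h : EmbedsInRestrictedPower W G) (f : G →* Q) :
    ∃ (R : Type u) (_ : Group R) (g : W →* R), EmbedsInRestrictedPower g.ker f.ker ∧
      EmbedsInRestrictedPower R Q := by
  obtain ⟨ι, p, hp, hpf⟩ := h
  let g : W →* (ι → Q) := MonoidHom.pi fun i => f.comp (p i)
  refine ⟨g.range, inferInstance, g.rangeRestrict, ?_, ?_⟩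
  · have hk : ∀ i, ∀ w : g.rangeRestrict.ker, p i w ∈ f.ker := fun i w =>
      congrFun (congrArg Subtype.val w.2) i
    refine ⟨ι, fun i => ((p i).comp (Subgroup.subtype _)).codRestrict f.ker (hk i),
      fun w hw => Subtype.ext (hp w fun i => congrArg Subtype.val (hw i)), fun w => ?_⟩
    refine (hpf w).subset fun i hi h1 => hi (Subtype.ext h1)
  · refine ⟨ι, fun i => (Pi.evalMonoidHom _ i).comp g.range.subtype,
      fun w hw => Subtype.ext (funext hw), ?_⟩
    rintro ⟨_, w, rfl⟩
    refine (hpf w).subset fun i hi h1 => hi ?_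
    change f (p i w) = 1
    rw [show p i w = 1 from h1, map_one]

theorem directPowerOmega (G : Type u) [Group G] :
    EmbedsInRestrictedPower (directPowerOmega G) G := by
  refine ⟨ULift.{u} ℕ, fun i => (Pi.evalMonoidHom (fun _ : ℕ => G) i.down).comp (Subgroup.subtype _),
    fun w hw => Subtype.ext (funext fun i => ?_), fun w => ?_⟩
  · exact hw ⟨i⟩
  · exact Set.Finite.preimage (ULift.down_injective.injOn) w.2

theorem comm {W G : Type u} [Group W] [Group G] (h : EmbedsInRestrictedPower W G)
    (hG : ∀ a b : G, a * b = b * a) (a b : W) : a * b = b * a := by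
  obtain ⟨ι, p, hp, -⟩ := h
  have := hp (a * b * (b * a)⁻¹) fun i => by
    rw [map_mul, map_inv, map_mul, map_mul, hG (p i a), mul_inv_cancel]
  exact mul_inv_eq_one.mp this

end EmbedsInRestrictedPower

end RestrictedPowers

/-! ### Iterated extensions of groups locally in a limit stage -/

section IteratedExtension

/-- For `m = 0`, the groups whose finitely generated subgroups lie in `EG α`; for `m + 1`, the
extensions of two groups of the class for `m`. -/
def IterLocallyEG (α : Ordinal.{u}) : ℕ → ∀ (G : Type u) [Group G], Prop
  | 0, G, _ => ∀ S : Subgroup G, S.FG → EG α S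
  | m + 1, G, _ => ∃ (Q : Type u) (_ : Group Q) (f : G →* Q),
      IterLocallyEG α m f.ker ∧ IterLocallyEG α m Q

namespace IterLocallyEG

variable {α : Ordinal.{u}}

/-- Finitely many generators involve finitely many coordinates, which settles `m = 0`; restricted
powers respect extensions, which settles the induction. -/
theorem of_embeds (hα : IsSuccLimit α) (m : ℕ) : ∀ {W G : Type u} [Group W] [Group G],
    EmbedsInRestrictedPower W G → IterLocallyEG α m G → IterLocallyEG α m W := by
  induction m with
  | zero =>
    rintro W G _ _ ⟨ι, p, hp, hpf⟩ hG S hS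
    obtain ⟨s, hs⟩ := id hS
    have hfin : {i | ∃ x ∈ s, p i x ≠ 1}.Finite := by
      refine ((s.finite_toSet).biUnion fun x _ => hpf x).subset ?_
      rintro i ⟨x, hx, hi⟩
      simp only [Set.mem_iUnion]
      exact ⟨x, hx, hi⟩
    refine EG_limit_of_finset hα hfin.toFinset (fun i => (p i).comp S.subtype) ?_ ?_
    · intro w hw
      refine Subtype.ext (hp w fun i => ?_)
      by_cases hi : i ∈ hfin.toFinset
      · exact hw i hi
      · have : S ≤ (p i).ker := by
          rw [← hs, Subgroup.closure_le]
          intro x hx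
          by_contra hne
          exact hi (hfin.mem_toFinset.mpr ⟨x, hx, hne⟩)
        exact this w.2
    · intro i _
      have : ((p i).comp S.subtype).range = S.map (p i) := by
        rw [MonoidHom.range_comp, Subgroup.range_subtype]
      rw [this]
      exact hG _ (Group.fg_of_subgroup_fg_map _ hS)
  | succ m ih =>
    rintro W G _ _ h ⟨Q, _, f, hk, hQ⟩
    obtain ⟨R, _, g, h1, h2⟩ := h.exists_hom f
    exact ⟨R, inferInstance, g, ih h1 hk, ih h2 hQ⟩

/-- Kernels in `EG α` are absorbed. -/
theorem of_hom (hα : IsSuccLimit α) (m : ℕ) : ∀ {G P : Type u} [Group G] [Group P] (f : G →* P),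
    EG α f.ker → IterLocallyEG α m P → IterLocallyEG α m G := by
  induction m with
  | zero =>
    intro G P _ _ f hk hP S hS
    refine EG_limit_of_hom hα (f.comp S.subtype) ?_ ?_
    · have h1 : ∀ x : (f.comp S.subtype).ker, S.subtype x ∈ f.ker := fun x => x.2
      exact EG_of_injective α ((S.subtype.comp (Subgroup.subtype _)).codRestrict f.ker h1)
        (fun x y hxy => by
          have h := congrArg Subtype.val hxy
          exact Subtype.ext (Subtype.ext h)) hk
    · rw [MonoidHom.range_comp, Subgroup.range_subtype]
      exact hP _ (Group.fg_of_subgroup_fg_map _ hS)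
  | succ m ih =>
    rintro G P _ _ f hk ⟨Q, _, g, hg, hQ⟩
    -- The quotient is kept; the kernel of `f` is absorbed into the kernel of the composite.
    refine ⟨Q, inferInstance, g.comp f, ?_, hQ⟩
    have h0 : ∀ x : (g.comp f).ker, f x ∈ g.ker := fun x => x.2
    refine ih ((f.comp (Subgroup.subtype _)).codRestrict g.ker h0) ?_ hg
    have h1 : ∀ x : ((f.comp (Subgroup.subtype _)).codRestrict g.ker h0).ker,
        (x : G) ∈ f.ker := fun x => congrArg Subtype.val x.2
    exact EG_of_injective α
      (((g.comp f).ker.subtype.comp (Subgroup.subtype _)).codRestrict f.ker h1)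
        (fun x y hxy => by
          have h := congrArg Subtype.val hxy
          exact Subtype.ext (Subtype.ext h)) hk

/-- The direct union of all finitely generated subgroups costs one step, and each of the `m`
extensions one more. -/
theorem eg_add_one (m : ℕ) : ∀ {G : Type u} [Group G], IterLocallyEG α m G →
    EG (α + m + 1) G := by
  induction m with
  | zero =>
    intro G _ h
    rw [Nat.cast_zero, add_zero, EG_add_one_iff]
    refine Or.inr ⟨{S | S.FG}, fun A hA B hB => ⟨A ⊔ B, hA.sup hB, le_sup_left, le_sup_right⟩,
      fun g => ⟨Subgroup.closure {g}, ⟨{g}, by simp⟩, Subgroup.mem_closure_singleton_self g⟩,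
      fun S hS => h S hS⟩
  | succ m ih =>
    rintro G _ ⟨Q, _, f, hk, hQ⟩
    rw [Nat.cast_add_one, ← add_assoc]
    exact EG_add_one_of_hom f f.range.subtype f.range.subtype_injective (ih hk) (ih hQ)

end IterLocallyEG

end IteratedExtension

/-! ### Restricted wreath products -/

section Wreath

namespace RegularWreathProduct

/-- The inclusion of the factor of the base group with a given index. -/
noncomputable def singleHom (D : Type*) {Q : Type*} [Group D] [Group Q] (q : Q) :
    D →* D ≀ᵣ Q where
  toFun d := ⟨by classical exact Pi.mulSingle q d, 1⟩
  map_one' := by ext <;> simp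
  map_mul' x y := by ext <;> simp [Pi.mulSingle_mul]

theorem singleHom_left_same {D Q : Type*} [Group D] [Group Q] (q : Q) (d : D) :
    (singleHom D q d).left q = d := by
  simp [singleHom]

theorem singleHom_left_of_ne {D Q : Type*} [Group D] [Group Q] {q x : Q} (h : x ≠ q) (d : D) :
    (singleHom D q d).left x = 1 := by
  simp [singleHom, h]

theorem singleHom_right {D Q : Type*} [Group D] [Group Q] (q : Q) (d : D) :
    (singleHom D q d).right = 1 := rfl

/-- The map of regular wreath products induced by a homomorphism of the base factors. -/
def mapLeft {D A : Type*} (Q : Type*) [Group D] [Group A] [Group Q] (f : D →* A) :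
    D ≀ᵣ Q →* A ≀ᵣ Q where
  toFun w := ⟨fun x => f (w.left x), w.right⟩
  map_one' := by ext <;> simp
  map_mul' x y := by ext <;> simp

theorem mul_comm_of_right_eq_one {A Q : Type*} [CommGroup A] [Group Q] {v w : A ≀ᵣ Q}
    (hv : v.right = 1) (hw : w.right = 1) : v * w = w * v := by
  ext x
  · simp [hv, hw, mul_comm]
  · simp [hv, hw]

end RegularWreathProduct

open RegularWreathProduct

/-- The restricted regular wreath product. -/
noncomputable def restrictedWreath (D Q : Type*) [Group D] [Group Q] : Subgroup (D ≀ᵣ Q) :=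
  (singleHom D (1 : Q)).range ⊔ (inl : Q →* D ≀ᵣ Q).range

namespace restrictedWreath

variable {D Q : Type*} [Group D] [Group Q]

theorem fg [Group.FG D] [Group.FG Q] : Group.FG (restrictedWreath D Q) := by
  rw [Group.fg_iff_subgroup_fg]
  exact ((Group.fg_iff_subgroup_fg _).mp inferInstance).sup
    ((Group.fg_iff_subgroup_fg _).mp inferInstance)

theorem finite_support (w : restrictedWreath D Q) : {x | (w : D ≀ᵣ Q).left x ≠ 1}.Finite := by
  let F : Subgroup (D ≀ᵣ Q) :=
    { carrier := {w | {x | w.left x ≠ 1}.Finite}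
      one_mem' := by simp
      mul_mem' := by
        intro a b ha hb
        refine (ha.union (hb.preimage (mul_right_injective a.right⁻¹).injOn)).subset ?_
        intro x hx
        by_contra hne
        simp only [Set.mem_union, Set.mem_ofPred_eq, Set.mem_preimage, not_or, not_not] at hne
        exact hx (by simp [hne.1, hne.2])
      inv_mem' := by
        intro a ha
        refine (ha.preimage (mul_right_injective a.right).injOn).subset ?_
        intro x hx hne
        exact hx (by simpa using hne) }
  have hle : restrictedWreath D Q ≤ F := by
    refine sup_le ?_ ?_
    · rintro _ ⟨d, rfl⟩
      refine (Set.finite_singleton (1 : Q)).subset fun x hx => ?_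
      by_contra hne
      exact hx (singleHom_left_of_ne hne d)
    · rintro _ ⟨q, rfl⟩
      change {x | (inl q : D ≀ᵣ Q).left x ≠ 1}.Finite
      simp
  exact hle w.2

theorem single_mem (d : D) : singleHom D (1 : Q) d ∈ restrictedWreath D Q :=
  (le_sup_left : _ ≤ restrictedWreath D Q) ⟨d, rfl⟩

theorem inl_mem (q : Q) : (inl q : D ≀ᵣ Q) ∈ restrictedWreath D Q :=
  (le_sup_right : _ ≤ restrictedWreath D Q) ⟨q, rfl⟩

variable (D Q) in
/-- The projection of the restricted wreath product to the acting group. -/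
noncomputable def proj : restrictedWreath D Q →* Q := rightHom.comp (restrictedWreath D Q).subtype

theorem proj_surjective : Function.Surjective (proj D Q) := fun q => ⟨⟨inl q, inl_mem q⟩, rfl⟩

/-- The evaluation homomorphism on the base group. -/
noncomputable def eval (q : Q) : (proj D Q).ker →* D where
  toFun w := (w : D ≀ᵣ Q).left q
  map_one' := rfl
  map_mul' v w := by
    have hv : (v : D ≀ᵣ Q).right = 1 := v.2
    simp [hv]

theorem eval_jointly_injective (w : (proj D Q).ker) (h : ∀ q, eval q w = 1) : w = 1 :=
  Subtype.ext (Subtype.ext (RegularWreathProduct.ext (funext h) w.2))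

theorem base_embeds (D Q : Type u) [Group D] [Group Q] :
    EmbedsInRestrictedPower (proj D Q).ker D :=
  ⟨Q, eval, eval_jointly_injective, fun w => finite_support (w : restrictedWreath D Q)⟩

/-- A normal subgroup that acts non-trivially has the base factor as a section. -/
theorem exists_mem_normal_eval_eq {N : Subgroup (restrictedWreath D Q)} (hN : N.Normal)
    {w : restrictedWreath D Q} (hw : w ∈ N) (hw1 : proj D Q w ≠ 1) (d : D) :
    ∃ v ∈ N, proj D Q v = 1 ∧ (v : D ≀ᵣ Q).left 1 = d := by
  set s : restrictedWreath D Q := ⟨singleHom D 1 d, single_mem d⟩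
  -- Conjugation by `w` moves the support of `s⁻¹` away from the identity, so the commutator keeps
  -- the value `d` there.
  refine ⟨s * w * s⁻¹ * w⁻¹, N.mul_mem (hN.conj_mem w hw s) (N.inv_mem hw), ?_, ?_⟩
  · have hs : proj D Q s = 1 := rfl
    simp [hs]
  · have hw2 : (w : D ≀ᵣ Q).right ≠ 1 := hw1
    have h3 : (singleHom D 1 d).left ((w : D ≀ᵣ Q).right⁻¹ * 1) = 1 :=
      singleHom_left_of_ne (by simpa using hw2) d
    simp only [mul_one] at h3
    simp [s, singleHom_right, singleHom_left_same, h3]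

/-- By finite generation only extensions matter. If `N` lies in the base, the quotient by `N` maps
onto `M`; otherwise the intersection of `N` with the base does, by evaluation at the identity. -/
theorem not_EG_add_one {β : Ordinal.{u}} {M : Type u} [Group M] [Group.FG M] (h : ¬ EG β M) :
    ¬ EG (β + 1) (restrictedWreath M M) := by
  have := fg (D := M) (Q := M)
  refine not_EG_add_one_of_fg ?_ fun h1 => h (EG_of_surjective β _ proj_surjective h1)
  intro N hN h1 h2
  by_cases hle : N ≤ (proj M M).ker
  · refine h (EG_of_surjective β (QuotientGroup.lift N (proj M M) hle) ?_ h2)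
    intro q
    obtain ⟨w, rfl⟩ := proj_surjective (D := M) q
    exact ⟨QuotientGroup.mk w, rfl⟩
  · obtain ⟨w, hw, hw1⟩ := SetLike.not_le_iff_exists.mp hle
    have h3 : EG β (N.comap (proj M M).ker.subtype) :=
      EG_of_injective β (((proj M M).ker.subtype.comp (Subgroup.subtype _)).codRestrict N
        fun x => x.2) (fun x y hxy => by
          have h := congrArg Subtype.val hxy
          exact Subtype.ext (Subtype.ext h)) h1
    refine h (EG_of_surjective β ((eval 1).comp (Subgroup.subtype _)) ?_ h3)
    intro d
    obtain ⟨v, hv, hv1, hv2⟩ := exists_mem_normal_eval_eq hN hw hw1 d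
    exact ⟨⟨⟨v, hv1⟩, hv⟩, hv2⟩

/-- Restricted powers of a restricted wreath product are extensions of restricted powers. -/
theorem EG_add_one_of_embeds {β : Ordinal.{u}} {M : Type u} [Group M]
    (h : ∀ (W : Type u) [Group W], EmbedsInRestrictedPower W M → EG β W)
    {W : Type u} [Group W] (hW : EmbedsInRestrictedPower W (restrictedWreath M M)) :
    EG (β + 1) W := by
  obtain ⟨R, _, g, h1, h2⟩ := hW.exists_hom (proj M M)
  exact EG_add_one_of_hom g g.range.subtype g.range.subtype_injective
    (h _ (h1.trans (base_embeds M M))) (h _ h2)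

theorem iterLocallyEG {α : Ordinal.{u}} (hα : IsSuccLimit α) {m : ℕ} {M : Type u} [Group M]
    {A : Type} [CommGroup A] (φ : M →* A) (h : IterLocallyEG α m φ.ker) :
    IterLocallyEG α (m + 1) (φ.comp (proj M M)).ker := by
  set K := (φ.comp (proj M M)).ker
  -- Applying `φ` to every coordinate splits `K`: the kernel consists of finitely supported
  -- functions into `φ.ker`, and the range is an extension of an abelian group of `A`-valued
  -- functions by a subgroup of `φ.ker`.
  let g : K →* A ≀ᵣ M := (mapLeft M φ).comp ((Subgroup.subtype _).comp K.subtype)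
  refine ⟨g.range, inferInstance, g.rangeRestrict, ?_, ?_⟩
  · refine IterLocallyEG.of_embeds hα m ?_ h
    have hr : ∀ w : g.rangeRestrict.ker, g w = 1 := fun w => congrArg Subtype.val w.2
    have hl : ∀ w : g.rangeRestrict.ker, (w : restrictedWreath M M) ∈ (proj M M).ker :=
      fun w => congrArg RegularWreathProduct.right (hr w)
    let j : g.rangeRestrict.ker →* (proj M M).ker :=
      (K.subtype.comp (Subgroup.subtype _)).codRestrict _ hl
    refine ⟨M, fun q => ((eval q).comp j).codRestrict φ.ker fun w =>
      congrFun (congrArg RegularWreathProduct.left (hr w)) q, fun w hw => ?_, fun w => ?_⟩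
    · have h1 : j w = 1 := eval_jointly_injective _ fun q => congrArg Subtype.val (hw q)
      have h2 := congrArg Subtype.val h1
      exact Subtype.ext (Subtype.ext h2)
    · exact (finite_support ((w : K) : restrictedWreath M M)).subset
        fun q hq h1 => hq (Subtype.ext h1)
  · have hp : ∀ x : g.range, (rightHom.comp g.range.subtype) x ∈ φ.ker := by
      rintro ⟨_, w, rfl⟩
      exact w.2
    refine IterLocallyEG.of_hom hα m ((rightHom.comp g.range.subtype).codRestrict φ.ker hp) ?_ h
    refine EG_of_comm _ fun x y => Subtype.ext (Subtype.ext ?_)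
    exact mul_comm_of_right_eq_one (congrArg Subtype.val x.2) (congrArg Subtype.val y.2)

end restrictedWreath

end Wreath

/-! ### Two-generated groups from functions supported on powers of two -/

section Lacunary

theorem Subgroup.exists_finset_mem_closure_image {G κ : Type*} [Group G] (s : κ → G) {g : G}
    (hg : g ∈ Subgroup.closure (Set.range s)) :
    ∃ K : Finset κ, g ∈ Subgroup.closure (s '' K) := by
  classical
  induction hg using Subgroup.closure_induction with
  | mem x hx =>
    obtain ⟨k, rfl⟩ := hx
    exact ⟨{k}, Subgroup.subset_closure ⟨k, by simp, rfl⟩⟩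
  | one => exact ⟨∅, one_mem _⟩
  | mul x y _ _ hx hy =>
    obtain ⟨K, hK⟩ := hx
    obtain ⟨L, hL⟩ := hy
    refine ⟨K ∪ L, mul_mem ?_ ?_⟩
    · exact Subgroup.closure_mono (Set.image_mono (by simp)) hK
    · exact Subgroup.closure_mono (Set.image_mono (by simp)) hL
  | inv x _ hx =>
    obtain ⟨K, hK⟩ := hx
    exact ⟨K, inv_mem hK⟩

theorem Subgroup.exists_finset_le_closure_image {G κ : Type*} [Group G] (s : κ → G)
    {S : Subgroup G} (hS : S.FG) (hle : S ≤ Subgroup.closure (Set.range s)) :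
    ∃ K : Finset κ, S ≤ Subgroup.closure (s '' K) := by
  classical
  obtain ⟨t, rfl⟩ := hS
  rw [Subgroup.closure_le] at hle
  choose! K hK using fun g (hg : g ∈ (t : Set G)) =>
    Subgroup.exists_finset_mem_closure_image s (hle hg)
  refine ⟨t.biUnion K, (Subgroup.closure_le _).mpr fun g hg => ?_⟩
  refine Subgroup.closure_mono (Set.image_mono ?_) (hK g hg)
  exact Finset.coe_subset.mpr (Finset.subset_biUnion_of_mem K hg)

theorem two_pow_sub_two_pow_injOn {a b i j : ℕ} (hij : i ≠ j)
    (h : (2 : ℤ) ^ a - 2 ^ b = 2 ^ i - 2 ^ j) : a = i ∧ b = j := by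
  -- If `i > a`, then `2 ^ i - 2 ^ j ≥ 2 ^ (i - 1) ≥ 2 ^ a > 2 ^ a - 2 ^ b`.
  have key : ∀ a b i j : ℕ, b < a → j < i → (2 : ℤ) ^ a - 2 ^ b = 2 ^ i - 2 ^ j → i ≤ a := by
    intro a b i j _ hji h
    by_contra hlt
    have h1 : (2 : ℤ) ^ (a + 1) ≤ 2 ^ i := pow_le_pow_right₀ (by norm_num) (by omega)
    have h2 : (2 : ℤ) ^ (j + 1) ≤ 2 ^ i := pow_le_pow_right₀ (by norm_num) (by omega)
    have h3 : (0 : ℤ) < 2 ^ b := by positivity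
    rw [pow_succ] at h1 h2
    linarith
  have mono : ∀ {x y : ℕ}, (2 : ℤ) ^ x < 2 ^ y ↔ x < y := pow_lt_pow_iff_right₀ (by norm_num)
  have inj : ∀ {x y : ℕ}, (2 : ℤ) ^ x = 2 ^ y → x = y := fun hxy =>
    Int.pow_right_injective (by norm_num) hxy
  rcases lt_or_gt_of_ne hij with hlt | hlt
  · have hba : a < b := mono.mp (by have := mono.mpr hlt; linarith)
    have hb : b = j := le_antisymm (key j i b a hlt hba (by linarith))
      (key b a j i hba hlt (by linarith))
    subst hb
    exact ⟨inj (by linarith), rfl⟩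
  · have hba : b < a := mono.mp (by have := mono.mpr hlt; linarith)
    have ha : a = i := le_antisymm (key i j a b hlt hba (by linarith))
      (key a b i j hba hlt (by linarith))
    subst ha
    exact ⟨rfl, inj (by linarith)⟩

/-- The function on `ℤ` with the given values at the powers of two, and trivial elsewhere. -/
noncomputable def lacunary {H : Type*} [Group H] (e : ℕ → H) : Multiplicative ℤ → H :=
  Function.extend (fun i => Multiplicative.ofAdd ((2 : ℤ) ^ i)) e 1

section

variable {H : Type u} [Group H] (e : ℕ → H)

theorem lacunary_two_pow (i : ℕ) : lacunary e (Multiplicative.ofAdd ((2 : ℤ) ^ i)) = e i :=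
  Function.Injective.extend_apply
    (fun _ _ h => Int.pow_right_injective (by norm_num) (Multiplicative.ofAdd.injective h)) _ _ _

theorem exists_of_lacunary_ne_one {x : Multiplicative ℤ} (h : lacunary e x ≠ 1) :
    ∃ i : ℕ, x = Multiplicative.ofAdd ((2 : ℤ) ^ i) := by
  by_contra hne
  refine h (Function.extend_apply' _ _ _ ?_)
  rintro ⟨i, hi⟩
  exact hne ⟨i, hi.symm⟩

/-- The translation action on functions. -/
def shiftHom (k : Multiplicative ℤ) : (Multiplicative ℤ → H) →* (Multiplicative ℤ → H) where
  toFun f x := f (k⁻¹ * x)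
  map_one' := rfl
  map_mul' _ _ := rfl

/-- A common point writes `l - k` as a difference of two powers of two; this determines both powers,
hence the point. -/
theorem shiftHom_lacunary_subsingleton {k l : Multiplicative ℤ} (hkl : k ≠ l) :
    {x | shiftHom k (lacunary e) x ≠ 1 ∧ shiftHom l (lacunary e) x ≠ 1}.Subsingleton := by
  rintro x ⟨hx1, hx2⟩ y ⟨hy1, hy2⟩
  obtain ⟨a, ha⟩ := exists_of_lacunary_ne_one e hx1
  obtain ⟨b, hb⟩ := exists_of_lacunary_ne_one e hx2
  obtain ⟨i, hi⟩ := exists_of_lacunary_ne_one e hy1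
  obtain ⟨j, hj⟩ := exists_of_lacunary_ne_one e hy2
  have ha' : x.toAdd - k.toAdd = 2 ^ a := by
    have := congrArg Multiplicative.toAdd ha; simp at this; linarith
  have hb' : x.toAdd - l.toAdd = 2 ^ b := by
    have := congrArg Multiplicative.toAdd hb; simp at this; linarith
  have hi' : y.toAdd - k.toAdd = 2 ^ i := by
    have := congrArg Multiplicative.toAdd hi; simp at this; linarith
  have hj' : y.toAdd - l.toAdd = 2 ^ j := by
    have := congrArg Multiplicative.toAdd hj; simp at this; linarith
  have hij : i ≠ j := by
    rintro rfl
    exact hkl (Multiplicative.toAdd.injective (by linarith))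
  obtain ⟨rfl, rfl⟩ := two_pow_sub_two_pow_injOn (a := a) (b := b) hij (by linarith)
  exact Multiplicative.toAdd.injective (by linarith)

/-- The group generated by the translates of a lacunary function. -/
noncomputable def lacunaryBase : Subgroup (Multiplicative ℤ → H) :=
  Subgroup.closure (Set.range fun k => shiftHom k (lacunary e))

theorem shiftHom_mem_lacunaryBase (k : Multiplicative ℤ) {b : Multiplicative ℤ → H}
    (hb : b ∈ lacunaryBase e) : shiftHom k b ∈ lacunaryBase e := by
  have : lacunaryBase e ≤ (lacunaryBase e).comap (shiftHom k) := by
    refine (Subgroup.closure_le _).mpr ?_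
    rintro _ ⟨j, rfl⟩
    refine Subgroup.subset_closure ⟨k * j, ?_⟩
    ext x
    simp [shiftHom, mul_assoc]
  exact this hb

theorem lacunary_comm_off_finite {K : Finset (Multiplicative ℤ)} {x : Multiplicative ℤ}
    (hx : ∀ k ∈ K, ∀ l ∈ K, shiftHom k (lacunary e) x ≠ 1 → shiftHom l (lacunary e) x ≠ 1 →
      k = l) {a b : Multiplicative ℤ → H}
    (ha : a ∈ Subgroup.closure ((fun k => shiftHom k (lacunary e)) '' K))
    (hb : b ∈ Subgroup.closure ((fun k => shiftHom k (lacunary e)) '' K)) :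
    a x * b x = b x * a x := by
  have key : ∀ k ∈ K, ∀ l ∈ K, Commute (shiftHom k (lacunary e) x)
      (shiftHom l (lacunary e) x) := by
    intro k hk l hl
    by_cases h1 : shiftHom k (lacunary e) x = 1
    · rw [h1]; exact Commute.one_left _
    by_cases h2 : shiftHom l (lacunary e) x = 1
    · rw [h2]; exact Commute.one_right _
    rw [hx k hk l hl h1 h2]
  have h1 : ∀ k ∈ K, Commute (shiftHom k (lacunary e) x) (b x) := by
    intro k hk
    induction hb using Subgroup.closure_induction with
    | mem y hy =>
      obtain ⟨l, hl, rfl⟩ := hy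
      exact key k hk l hl
    | one => exact Commute.one_right _
    | mul y z _ _ hy hz => exact hy.mul_right hz
    | inv y _ hy => exact hy.inv_right
  change Commute (a x) (b x)
  induction ha using Subgroup.closure_induction with
  | mem y hy =>
    obtain ⟨l, hl, rfl⟩ := hy
    exact h1 l hl
  | one => exact Commute.one_left _
  | mul y z _ _ hy hz => exact hy.mul_left hz
  | inv y _ hy => exact hy.inv_left

/-- Finitely many translates overlap only in a finite set `E`. Restriction to `E` lands in a finite
power of `H`; its kernel is abelian, since off `E` at most one translate is non-trivial at each
point. -/
theorem lacunaryBase_locallyEG {α : Ordinal.{u}} (hα : IsSuccLimit α)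
    (hH : IterLocallyEG α 0 H) : IterLocallyEG α 0 (lacunaryBase e) := by
  intro S hS
  obtain ⟨K, hK⟩ := Subgroup.exists_finset_le_closure_image _
    (Group.fg_of_subgroup_fg_map (lacunaryBase e).subtype hS) (by
      rintro _ ⟨w, _, rfl⟩
      exact w.2)
  have hmem : ∀ w : S, ((w : lacunaryBase e) : Multiplicative ℤ → H) ∈
      Subgroup.closure ((fun k => shiftHom k (lacunary e)) '' K) := fun w => hK ⟨w, w.2, rfl⟩
  let E : Set (Multiplicative ℤ) := {x | ∃ k ∈ K, ∃ l ∈ K, k ≠ l ∧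
    shiftHom k (lacunary e) x ≠ 1 ∧ shiftHom l (lacunary e) x ≠ 1}
  have hE : E.Finite := by
    refine ((K.finite_toSet.biUnion fun k _ => K.finite_toSet.biUnion fun l _ =>
      (show {x | k ≠ l ∧ shiftHom k (lacunary e) x ≠ 1 ∧
        shiftHom l (lacunary e) x ≠ 1}.Finite from ?_))).subset ?_
    · by_cases hkl : k = l
      · simp [hkl]
      · exact (shiftHom_lacunary_subsingleton e hkl).finite.subset fun x hx => hx.2
    · rintro x ⟨k, hk, l, hl, hx⟩
      simp only [Set.mem_iUnion]
      exact ⟨k, hk, l, hl, hx⟩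
  have : Finite E := hE
  let g : S →* (E → H) :=
    MonoidHom.pi fun x => (Pi.evalMonoidHom (fun _ => H) (x : Multiplicative ℤ)).comp
      ((lacunaryBase e).subtype.comp S.subtype)
  have hR : EmbedsInRestrictedPower g.range H :=
    ⟨ULift.{u} E, fun x => (Pi.evalMonoidHom (fun _ => H) x.down).comp g.range.subtype,
      fun w hw => Subtype.ext (funext fun x => hw ⟨x⟩), fun w => Set.toFinite _⟩
  have hfg : (⊤ : Subgroup g.range).FG := by
    have : Group.FG S := (Group.fg_iff_subgroup_fg S).mpr hS
    exact (inferInstance : Group.FG g.range).out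
  have hr : EG α g.range :=
    EG_of_surjective α (Subgroup.subtype ⊤) (fun x => ⟨⟨x, trivial⟩, rfl⟩)
      (IterLocallyEG.of_embeds hα 0 hR hH ⊤ hfg)
  refine EG_limit_of_hom hα g (EG_of_comm _ fun a b => ?_) hr
  refine Subtype.ext (Subtype.ext (Subtype.ext (funext fun x => ?_)))
  by_cases hx : x ∈ E
  · have ha : (((a : S) : lacunaryBase e) : Multiplicative ℤ → H) x = 1 := congrFun a.2 ⟨x, hx⟩
    have hb : (((b : S) : lacunaryBase e) : Multiplicative ℤ → H) x = 1 := congrFun b.2 ⟨x, hx⟩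
    simp [ha, hb]
  · refine lacunary_comm_off_finite e ?_ (hmem a) (hmem b)
    intro k hk l hl h1 h2
    by_contra hkl
    exact hx ⟨k, hk, l, hl, hkl, h1, h2⟩

open RegularWreathProduct

/-- The two-generated group spanned by a lacunary function and the translation. -/
noncomputable def lacunaryWreath : Subgroup (H ≀ᵣ Multiplicative ℤ) :=
  Subgroup.closure {⟨lacunary e, 1⟩, inl (Multiplicative.ofAdd 1)}

namespace lacunaryWreath

theorem fg : Group.FG (lacunaryWreath e) := Group.closure_finite_fg _

theorem left_mem {w : H ≀ᵣ Multiplicative ℤ} (hw : w ∈ lacunaryWreath e) :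
    w.left ∈ lacunaryBase e := by
  induction hw using Subgroup.closure_induction with
  | mem w hw =>
    rcases hw with rfl | rfl
    · exact Subgroup.subset_closure ⟨1, by ext x; simp [shiftHom]⟩
    · exact one_mem _
  | one => exact one_mem _
  | mul v w _ _ hv hw => exact mul_mem hv (shiftHom_mem_lacunaryBase e v.right hw)
  | inv w _ hw =>
    have h := shiftHom_mem_lacunaryBase e w.right⁻¹ (inv_mem hw)
    simpa [shiftHom] using h

/-- The projection to the infinite cyclic group. -/
noncomputable def proj : lacunaryWreath e →* Multiplicative ℤ :=
  rightHom.comp (lacunaryWreath e).subtype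

theorem ker_proj_locallyEG {α : Ordinal.{u}} (hα : IsSuccLimit α) (hH : IterLocallyEG α 0 H) :
    IterLocallyEG α 0 (proj e).ker := by
  let j : (proj e).ker →* lacunaryBase e :=
    { toFun := fun w => ⟨(w : H ≀ᵣ Multiplicative ℤ).left, left_mem e (w : lacunaryWreath e).2⟩
      map_one' := rfl
      map_mul' := fun v w => by
        have hv : (v : H ≀ᵣ Multiplicative ℤ).right = 1 := v.2
        ext x
        simp [hv] }
  refine IterLocallyEG.of_embeds hα 0 (EmbedsInRestrictedPower.of_injective j ?_)
    (lacunaryBase_locallyEG e hα hH)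
  intro v w h
  exact Subtype.ext (Subtype.ext (RegularWreathProduct.ext (congrArg Subtype.val h)
    (v.2.trans w.2.symm)))

theorem shiftHom_mem (k : Multiplicative ℤ) :
    (⟨shiftHom k (lacunary e), 1⟩ : H ≀ᵣ Multiplicative ℤ) ∈ lacunaryWreath e := by
  have ht : (inl k : H ≀ᵣ Multiplicative ℤ) ∈ lacunaryWreath e := by
    have h1 : (inl (Multiplicative.ofAdd 1) : H ≀ᵣ Multiplicative ℤ) ∈ lacunaryWreath e :=
      Subgroup.subset_closure (by simp)
    have h2 : k = Multiplicative.ofAdd (1 : ℤ) ^ k.toAdd := by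
      rw [← ofAdd_zsmul]; simp
    rw [h2, map_zpow]
    exact zpow_mem h1 _
  have hf : (⟨lacunary e, 1⟩ : H ≀ᵣ Multiplicative ℤ) ∈ lacunaryWreath e :=
    Subgroup.subset_closure (by simp)
  have h3 := mul_mem (mul_mem ht hf) (inv_mem ht)
  convert h3 using 1
  ext x <;> simp [shiftHom]

/-- The translates by `-2 ^ i` and `-2 ^ j` take the values `e i` and `e j` at the origin and
overlap nowhere else, so their commutator is supported there. -/
theorem single_commutator_mem (i j : ℕ) :
    singleHom H (1 : Multiplicative ℤ) (e i * e j * (e i)⁻¹ * (e j)⁻¹) ∈ lacunaryWreath e := by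
  by_cases hij : i = j
  · subst hij
    simp
  let k : ℕ → Multiplicative ℤ := fun i => (Multiplicative.ofAdd ((2 : ℤ) ^ i))⁻¹
  have hk : ∀ i, shiftHom (k i) (lacunary e) 1 = e i := fun i => by
    simp [shiftHom, k, lacunary_two_pow]
  have hkij : k i ≠ k j := fun h => hij
    (Int.pow_right_injective (by norm_num)
      (Multiplicative.ofAdd.injective (inv_injective h)))
  have h1 := mul_mem (mul_mem (mul_mem (shiftHom_mem e (k i)) (shiftHom_mem e (k j)))
    (inv_mem (shiftHom_mem e (k i)))) (inv_mem (shiftHom_mem e (k j)))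
  convert h1 using 1
  ext x
  · by_cases hx : x = 1
    · subst hx
      rw [singleHom_left_same]
      simp [hk]
    · rw [singleHom_left_of_ne hx]
      by_cases hi : shiftHom (k i) (lacunary e) x = 1
      · simp [hi]
      · by_cases hj : shiftHom (k j) (lacunary e) x = 1
        · simp [hj]
        · exfalso
          obtain ⟨a, ha⟩ := exists_of_lacunary_ne_one e hi
          obtain ⟨b, hb⟩ := exists_of_lacunary_ne_one e hj
          have ha' := congrArg Multiplicative.toAdd ha
          have hb' := congrArg Multiplicative.toAdd hb
          simp only [k, inv_inv, toAdd_mul, toAdd_ofAdd] at ha' hb'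
          obtain ⟨rfl, rfl⟩ := two_pow_sub_two_pow_injOn (a := a) (b := b) hij (by linarith)
          exact hx (Multiplicative.toAdd.injective (by rw [toAdd_one]; linarith))
  · simp [singleHom_right]

end lacunaryWreath

end

end Lacunary

/-! ### Groups above a limit ordinal -/

section LimitStage

theorem Group.countable_of_fg (G : Type*) [Group G] [h : Group.FG G] : Countable G := by
  obtain ⟨S, _, φ, hφ⟩ := Group.fg_iff_exists_freeGroup_hom_surjective_finite.mp h
  exact hφ.countable

/-- The derived subgroup of `H` embeds in `lacunaryWreath e` at the origin and `H` is abelian over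
it, so membership of the latter in `EG α` would force that of `H`. -/
theorem lacunaryWreath.not_EG_add_one {α : Ordinal.{u}} (hα : IsSuccLimit α) {H : Type u}
    [Group H] {e : ℕ → H} (he : Function.Surjective e) (hH : ¬ EG α H) :
    ¬ EG (α + 1) (lacunaryWreath e) := by
  have := lacunaryWreath.fg e
  have h0 : ¬ EG α (lacunaryWreath e) := by
    intro h
    refine hH (EG_limit_of_hom hα (Abelianization.of (G := H)) ?_
      (EG_of_comm _ fun a b => mul_comm a b))
    have hle : (Abelianization.of (G := H)).ker ≤
        (lacunaryWreath e).comap (RegularWreathProduct.singleHom H (1 : Multiplicative ℤ)) := by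
      rw [Abelianization.ker_of, commutator_def, Subgroup.commutator_le]
      intro a _ b _
      obtain ⟨i, rfl⟩ := he a
      obtain ⟨j, rfl⟩ := he b
      exact lacunaryWreath.single_commutator_mem e i j
    refine EG_of_injective α (((RegularWreathProduct.singleHom H (1 : Multiplicative ℤ)).comp
      (Subgroup.subtype _)).codRestrict (lacunaryWreath e) fun x => hle x.2) ?_ h
    intro x y hxy
    have h1 : (RegularWreathProduct.singleHom H (1 : Multiplicative ℤ) x).left 1 =
        (RegularWreathProduct.singleHom H (1 : Multiplicative ℤ) y).left 1 :=
      congrFun (congrArg RegularWreathProduct.left (congrArg Subtype.val hxy)) 1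
    rw [RegularWreathProduct.singleHom_left_same, RegularWreathProduct.singleHom_left_same] at h1
    exact Subtype.ext h1
  refine not_EG_add_one_of_fg (fun N _ h1 h2 => ?_) h0
  refine h0 (EG_limit_of_hom hα (QuotientGroup.mk' N) ?_ ?_)
  · rwa [QuotientGroup.ker_mk']
  · exact EG_of_injective α (Subgroup.subtype _) (Subgroup.subtype_injective _) h2

/-- The sequences that are eventually trivial. -/
def eventuallyOne (G : ℕ → Type u) [∀ i, Group (G i)] : Subgroup (∀ i, G i) where
  carrier := {f | ∃ n, ∀ i, n ≤ i → f i = 1}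
  one_mem' := ⟨0, fun _ _ => rfl⟩
  mul_mem' := by
    rintro f g ⟨m, hm⟩ ⟨n, hn⟩
    exact ⟨max m n, fun i hi => by
      simp [hm i (le_trans (le_max_left _ _) hi), hn i (le_trans (le_max_right _ _) hi)]⟩
  inv_mem' := by
    rintro f ⟨m, hm⟩
    exact ⟨m, fun i hi => by simp [hm i hi]⟩

theorem countable_eventuallyOne (G : ℕ → Type u) [∀ i, Group (G i)] [∀ i, Countable (G i)] :
    Countable (eventuallyOne G) := by
  choose N hN using fun f : eventuallyOne G => f.2
  refine Function.Injective.countable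
    (f := fun f => (⟨N f, fun i => f.1 i⟩ : Σ n : ℕ, ∀ i : Fin n, G i)) ?_
  intro f g hfg
  obtain ⟨h1, h2⟩ := Sigma.mk.inj hfg
  refine Subtype.ext (funext fun i => ?_)
  by_cases hi : i < N f
  · have : ∀ (n : ℕ), N f = n → (fun i : Fin (N f) => f.1 i) ≍ (fun i : Fin n => g.1 i) →
        f.1 i = g.1 i := by
      rintro n rfl h
      exact congrFun (eq_of_heq h) ⟨i, hi⟩
    exact this _ h1 h2
  · rw [hN f i (by omega), hN g i (by omega)]

theorem eventuallyOne_locallyEG {α : Ordinal.{u}} (hα : IsSuccLimit α) (G : ℕ → Type u)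
    [∀ i, Group (G i)] (hG : ∀ i, EG α (G i)) : IterLocallyEG α 0 (eventuallyOne G) := by
  rintro S ⟨t, rfl⟩
  choose N hN using fun f : eventuallyOne G => f.2
  let ev : ∀ i, eventuallyOne G →* G i := fun i =>
    (Pi.evalMonoidHom G i).comp (Subgroup.subtype _)
  have key : ∀ i, i ∉ Finset.range (t.sup N) → Subgroup.closure (t : Set _) ≤ (ev i).ker := by
    intro i hi
    refine (Subgroup.closure_le _).mpr fun f hf => hN f i ?_
    exact (Finset.le_sup (f := N) hf).trans (by simpa using hi)
  refine EG_limit_of_finset hα (Finset.range (t.sup N))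
    (fun i => (ev i).comp (Subgroup.subtype _)) ?_ fun i _ =>
      EG_of_injective α (Subgroup.subtype _) (Subgroup.subtype_injective _) (hG i)
  intro w hw
  refine Subtype.ext (Subtype.ext (funext fun i => ?_))
  by_cases hi : i ∈ Finset.range (t.sup N)
  · exact hw i hi
  · exact key i hi w.2

/-- Countability of `α` allows one factor for each `β < α` in a sequence; projecting to the factor
for `β` excludes `EG β`. -/
theorem exists_countable_locallyEG {α : Ordinal.{u}} (hα : IsSuccLimit α)
    (hαc : α.card ≤ Cardinal.aleph0)
    (h : ∀ β < α, ∃ (G : Type u) (_ : Group G), Group.FG G ∧ ¬ EG β G ∧ EG α G) :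
    ∃ (H : Type u) (_ : Group H), Countable H ∧ IterLocallyEG α 0 H ∧ ¬ EG α H := by
  have hc : Countable (Set.Iio α) := by
    rw [← Cardinal.mk_le_aleph0_iff, Cardinal.mk_Iio_ordinal]
    exact Cardinal.lift_le_aleph0.mpr hαc
  have hne : Nonempty (Set.Iio α) := ⟨⟨0, hα.bot_lt⟩⟩
  obtain ⟨b, hb⟩ := exists_surjective_nat (Set.Iio α)
  choose G hG hfg hnot hmem using fun i => h (b i) (b i).2
  have : ∀ i, Countable (G i) := fun i => Group.countable_of_fg (G i)
  refine ⟨eventuallyOne G, inferInstance, countable_eventuallyOne G,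
    eventuallyOne_locallyEG hα G hmem, fun hE => ?_⟩
  obtain ⟨β, hβ, hE⟩ := (EG_limit_iff hα _).mp hE
  obtain ⟨i, hi⟩ := hb ⟨β, hβ⟩
  refine hnot i ?_
  rw [hi]
  refine EG_of_surjective β ((Pi.evalMonoidHom G i).comp (eventuallyOne G).subtype) ?_ hE
  intro g
  refine ⟨⟨Pi.mulSingle i g, i + 1, fun j hj => Pi.mulSingle_eq_of_ne (by omega) g⟩, ?_⟩
  simp

/-- The finitely generated group at the bottom of a stage above a limit ordinal. -/
theorem exists_fg_over_limit {α : Ordinal.{u}} (hα : IsSuccLimit α) {H : Type u} [Group H]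
    [Countable H] (h1 : IterLocallyEG α 0 H) (h2 : ¬ EG α H) :
    ∃ (L : Type u) (_ : Group L), Group.FG L ∧ ¬ EG (α + 1) L ∧
      ∃ φ : L →* Multiplicative ℤ, IterLocallyEG α 0 φ.ker := by
  obtain ⟨e, he⟩ := exists_surjective_nat H
  exact ⟨lacunaryWreath e, inferInstance, lacunaryWreath.fg e,
    lacunaryWreath.not_EG_add_one hα he h2, lacunaryWreath.proj e,
    lacunaryWreath.ker_proj_locallyEG e hα h1⟩

/-- A restricted power of `L` is abelian over a restricted power of `φ.ker`, so it costs one step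
more than the latter. -/
theorem EG_of_embeds_of_ker {α : Ordinal.{u}} (hα : IsSuccLimit α) {m : ℕ} {L : Type u} [Group L]
    {φ : L →* Multiplicative ℤ} (h : IterLocallyEG α m φ.ker) {W : Type u} [Group W]
    (hW : EmbedsInRestrictedPower W L) : EG (α + m + 2) W := by
  obtain ⟨R, _, g, h1, h2⟩ :=
    hW.exists_hom ((MulEquiv.ulift.{0, u} (α := Multiplicative ℤ)).symm.toMonoidHom.comp φ)
  have hk : (MulEquiv.ulift.symm.toMonoidHom.comp φ).ker = φ.ker := by
    ext x
    simp [MonoidHom.mem_ker]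
  rw [hk] at h1
  have h3 := IterLocallyEG.eg_add_one m (IterLocallyEG.of_embeds hα m h1 h)
  rw [← one_add_one_eq_two, ← add_assoc]
  exact EG_add_one_of_hom g g.range.subtype g.range.subtype_injective h3
    (EG_of_comm _ (h2.comm mul_comm))

/-- The finite excess `k` is harmless, as `β + k` stays below any limit above `β`. The bound covers
restricted powers because the base of a wreath product is one. -/
theorem exists_fg_not_EG (β : Ordinal.{u}) (hβ : β.card ≤ Cardinal.aleph0) :
    ∃ (G : Type u) (_ : Group G), Group.FG G ∧ ¬ EG β G ∧
      ∃ k : ℕ, ∀ (W : Type u) [Group W], EmbedsInRestrictedPower W G → EG (β + k) W := by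
  induction β using WellFoundedLT.induction with
  | ind β ih =>
  rcases Ordinal.zero_or_succ_or_isSuccLimit β with rfl | ⟨γ, rfl⟩ | hlim
  -- ℤ itself lies in `EG 0`, so the induction starts from its wreath product with itself.
  · let Z := ULift.{u} (Multiplicative ℤ)
    have hZ : Group.FG Z := Group.fg_of_surjective
      (f := (MulEquiv.ulift.{0, u} (α := Multiplicative ℤ)).symm.toMonoidHom)
      (MulEquiv.surjective _)
    refine ⟨restrictedWreath Z Z, inferInstance, restrictedWreath.fg, ?_, 1, ?_⟩
    · rw [EG_zero_iff]
      rintro (hf | hcomm)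
      · have : Finite Z := Finite.of_surjective _ (restrictedWreath.proj_surjective (D := Z))
        exact not_finite Z
      · let z : Z := ⟨Multiplicative.ofAdd 1⟩
        have hz : z ≠ 1 := fun h =>
          one_ne_zero (α := ℤ) (congrArg (fun t : Z => t.down.toAdd) h)
        have hz' : z⁻¹ * 1 ≠ 1 := by simpa using hz
        have h1 := congrFun (congrArg RegularWreathProduct.left (congrArg Subtype.val (hcomm
          ⟨RegularWreathProduct.singleHom Z 1 z, restrictedWreath.single_mem z⟩
          ⟨RegularWreathProduct.inl z, restrictedWreath.inl_mem z⟩))) 1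
        have h2 := RegularWreathProduct.singleHom_left_of_ne hz' z
        rw [mul_one] at h2
        exact hz (by simpa [RegularWreathProduct.singleHom_left_same, h2] using h1)
    · intro W _ hW
      rw [Nat.cast_one]
      refine restrictedWreath.EG_add_one_of_embeds (M := Z) ?_ hW
      exact fun V _ hV => EG_of_comm _ (hV.comm mul_comm)
  · obtain ⟨G, _, hfg, hnot, k, hk⟩ := ih γ (Order.lt_succ γ)
      ((Ordinal.card_le_card (Order.le_succ γ)).trans hβ)
    refine ⟨restrictedWreath G G, inferInstance, restrictedWreath.fg, ?_, k, ?_⟩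
    · exact restrictedWreath.not_EG_add_one hnot
    · intro W _ hW
      have := restrictedWreath.EG_add_one_of_embeds (M := G) hk hW
      have h1 : Order.succ γ + (k : Ordinal) = γ + k + 1 := by
        rw [Order.succ_eq_add_one, add_assoc, add_assoc, ← Nat.cast_one, ← Nat.cast_add,
          ← Nat.cast_add, Nat.add_comm]
      rwa [h1]
  · obtain ⟨H, _, hc, h1, h2⟩ := exists_countable_locallyEG hlim hβ fun γ hγ => by
      obtain ⟨G, hG, hfg, hnot, k, hk⟩ := ih γ hγ ((Ordinal.card_le_card hγ.le).trans hβ)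
      refine ⟨G, hG, hfg, hnot, EG_mono ?_ (hk G (.refl G))⟩
      exact (hlim.add_natCast_lt hγ k).le
    obtain ⟨L, hL, hfg, hnot, φ, hφ⟩ := exists_fg_over_limit hlim h1 h2
    refine ⟨L, hL, hfg, fun h => hnot (EG_add_one_of_EG h), 2, fun W _ hW => ?_⟩
    simpa using EG_of_embeds_of_ker hlim hφ hW

theorem exists_fg_iterLocallyEG {α : Ordinal.{u}} (hα : IsSuccLimit α) {H : Type u} [Group H]
    [Countable H] (h1 : IterLocallyEG α 0 H) (h2 : ¬ EG α H) (m : ℕ) :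
    ∃ (L : Type u) (_ : Group L), Group.FG L ∧ ¬ EG (α + m + 1) L ∧
      ∃ φ : L →* Multiplicative ℤ, IterLocallyEG α m φ.ker := by
  induction m with
  | zero => simpa using exists_fg_over_limit hα h1 h2
  | succ m ih =>
    obtain ⟨L, _, hfg, hnot, φ, hφ⟩ := ih
    refine ⟨restrictedWreath L L, inferInstance, restrictedWreath.fg, ?_, _,
      restrictedWreath.iterLocallyEG hα φ hφ⟩
    rw [Nat.cast_add_one, ← add_assoc]
    exact restrictedWreath.not_EG_add_one hnot

theorem hasElementaryClass_add_one {β : Ordinal.{u}} {G : Type u} [Group G] (h : EG (β + 1) G)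
    (h' : ¬ EG β G) : HasElementaryClass G (β + 1) :=
  ⟨h, fun γ hγ => by
    by_contra hlt
    exact h' (EG_mono (Order.lt_add_one_iff.mp (not_le.mp hlt)) hγ)⟩

theorem exists_hasElementaryClass_le {β : Ordinal.{u}} {G : Type u} [Group G] (h : EG β G) :
    ∃ γ, HasElementaryClass G γ ∧ γ ≤ β :=
  ⟨sInf {γ | EG γ G}, ⟨csInf_mem ⟨β, h⟩, fun _ hγ => csInf_le' hγ⟩, csInf_le' h⟩

theorem MemE.locallyEG {α : Ordinal.{u}} (hα : IsSuccLimit α) {H K : Type u} [Group H] [Group K]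
    (hH : IterLocallyEG α 0 H) (hK : MemE H K) : IterLocallyEG α 0 K := by
  intro S hS
  obtain ⟨m, f, hf⟩ := hK S hS
  have hE : EmbedsInRestrictedPower S H :=
    ⟨ULift.{u} (Fin m), fun i => (Pi.evalMonoidHom (fun _ => H) i.down).comp f,
      fun w hw => (injective_iff_map_eq_one f).mp hf w (funext fun i => hw ⟨i⟩),
      fun w => Set.toFinite _⟩
  have : Group.FG S := (Group.fg_iff_subgroup_fg S).mpr hS
  exact EG_of_surjective α (Subgroup.subtype ⊤) (fun x => ⟨⟨x, trivial⟩, rfl⟩)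
    (IterLocallyEG.of_embeds hα 0 hE hH ⊤ this.out)

end LimitStage

theorem mainTheorem5 (α : Ordinal.{u}) (hα : Order.IsSuccLimit α)
    (hαc : α.card ≤ Cardinal.aleph0) :
    (∃ (H : Type u) (_ : Group H), Countable H ∧ HasElementaryClass H (α + 1) ∧
      ∀ (K : Type u) [Group K], MemE H K →
        ∃ β : Ordinal.{u}, HasElementaryClass K β ∧ β ≤ α + 1) ∧
    (∀ n : ℕ, 2 ≤ n → ∃ (L : Type u) (_ : Group L), Group.FG L ∧
      HasElementaryClass L (α + n) ∧ HasElementaryClass (directPowerOmega L) (α + n)) := by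
  obtain ⟨H, hH, hc, h1, h2⟩ := exists_countable_locallyEG hα hαc fun γ hγ => by
    obtain ⟨G, hG, hfg, hnot, k, hk⟩ :=
      exists_fg_not_EG γ ((Ordinal.card_le_card hγ.le).trans hαc)
    exact ⟨G, hG, hfg, hnot, EG_mono (hα.add_natCast_lt hγ k).le (hk G (.refl G))⟩
  have locally_le : ∀ (K : Type u) [Group K], IterLocallyEG α 0 K → EG (α + 1) K :=
    fun K _ hK => by simpa using IterLocallyEG.eg_add_one 0 hK
  refine ⟨⟨H, hH, hc, hasElementaryClass_add_one (locally_le H h1) h2, fun K _ hK =>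
    exists_hasElementaryClass_le (locally_le K (hK.locallyEG hα h1))⟩, fun n hn => ?_⟩
  -- The first finitely generated group above the limit already has class `α + 2`; `m` counts the
  -- wreath products.
  obtain ⟨m, rfl⟩ := Nat.exists_eq_add_of_le' hn
  obtain ⟨L, hL, hfg, hnot, φ, hφ⟩ := exists_fg_iterLocallyEG hα h1 h2 m
  have hm : α + ((m + 2 : ℕ) : Ordinal.{u}) = α + m + 1 + 1 := by
    push_cast
    rw [← one_add_one_eq_two, ← add_assoc, ← add_assoc]
  have hup : ∀ (W : Type u) [Group W], EmbedsInRestrictedPower W L → EG (α + m + 1 + 1) W :=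
    fun W _ hW => by
      have := EG_of_embeds_of_ker hα hφ hW
      rwa [← one_add_one_eq_two, ← add_assoc] at this
  refine ⟨L, hL, hfg, ?_, ?_⟩
  · rw [hm]
    exact hasElementaryClass_add_one (hup L (.refl L)) hnot
  · rw [hm]
    refine hasElementaryClass_add_one (hup _ (.directPowerOmega L)) fun h => hnot ?_
    refine EG_of_surjective _ ((Pi.evalMonoidHom (fun _ => L) 0).comp
      (directPowerOmega L).subtype) (fun x => ⟨⟨Pi.mulSingle 0 x, ?_⟩, ?_⟩) h
    · exact (Set.finite_singleton 0).subset Pi.mulSupport_mulSingle_subset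
    · simp
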